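/- A nondeterministic (syntactic) read-once branching program (NROBP) over a set of Boolean variables is a finite directed acyclic graph, possibly with multiple edges, with exactly one root (source) and exactly one leaf (sink), some of whose edges are labelled by literals of the variables, such that no directed path contains two edges labelled by literals of the same variable. It computes the Boolean function $F$ if every truth assignment extending the set of literals on some root-leaf path satisfies $F$, and conversely every satisfying assignment of $F$ extends the set of literals on some root-leaf path. For a finite graph $G$ without isolated vertices, let $\varphi(G)$ be the monotone 2-CNF whose variables are the vertices of $G$ and whose clauses are $(u\vee v)$ for the edges $\{u,v\}$ of $G$; its primal graph is $G$. **Theorem.** There is a constant $c>0$ such that for every integer $k\ge 3$ there is an infinite class $\mathbf G$ of finite graphs without isolated vertices (infinite up to isomorphism), each of treewidth at most $k$, such that for every $G\in\mathbf G$, every NROBP computing $\varphi(G)$ has size at least $n^{k/c}$, where $n$ is the number of variables of $\varphi(G)$; this holds both for the number of nodes and for the number of edges as the measure of size. Consequently, NROBP size is not fixed-parameter in the primal treewidth: there are no function $f:\mathbb N\to\mathbb R$ and real constant $d$ such that, for all $k$, every formula $\varphi(G)$ with $n$ variables and primal graph of treewidth at most $k$ ($G$ a finite graph without isolated vertices)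 is computed by an NROBP whose number of nodes, or whose number of edges, is at most $f(k)\,n^{d}$. -/

import Mathlib

/-! ### Tree decompositions and treewidth -/

/-- A (finite) tree decomposition of the graph `G`. -/
structure SimpleGraph.TreeDecomposition {V : Type*} (G : SimpleGraph V) where
  /-- the nodes of the decomposition tree -/
  T : Type
  [fintypeT : Fintype T]
  /-- the decomposition tree -/
  tree : SimpleGraph T
  isTree : tree.IsTree
  /-- the bags -/
  bag : T → Finset V
  /-- every vertex is in some bag -/
  union : ∀ v : V, ∃ t : T, v ∈ bag t
  /-- every edge is contained in some bag -/
  containment : ∀ u v : V, G.Adj u v → ∃ t : T, u ∈ bag t ∧ v ∈ bag t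
  /-- the nodes whose bags contain a given vertex induce a subtree -/
  connectedness : ∀ v : V, (tree.induce {t : T | v ∈ bag t}).Connected

attribute [instance] SimpleGraph.TreeDecomposition.fintypeT

/-- The width: the size of the largest bag, minus one. -/
def SimpleGraph.TreeDecomposition.width {V : Type*} {G : SimpleGraph V}
    (D : G.TreeDecomposition) : ℕ :=
  (Finset.univ.sup fun t : D.T => (D.bag t).card) - 1

/-- The treewidth: the smallest width of a tree decomposition (which exists for every finite
graph). -/
noncomputable def SimpleGraph.treewidth {V : Type*} (G : SimpleGraph V) : ℕ :=
  sInf (Set.range fun D : G.TreeDecomposition => D.width)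

/-! ### CNF formulas -/

/-- A literal of a variable from `V`; `sign = true` means that it is positive. -/
structure BoolLiteral (V : Type*) where
  /-- the underlying variable -/
  var : V
  /-- `true` for the literal `v`, `false` for the literal `¬ v` -/
  sign : Bool

/-- The truth assignment `x` makes the literal `l` true. -/
def BoolLiteral.Holds {V : Type*} (l : BoolLiteral V) (x : V → Bool) : Prop :=
  x l.var = l.sign

/-- A CNF formula: a set of clauses, each of which is a set of literals. -/
structure CNFFormula (V : Type*) where
  /-- the clauses -/
  clauses : Set (Set (BoolLiteral V))

namespace CNFFormula

variable {V : Type*}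

/-- The Boolean function of the formula: every clause has a true literal. -/
def Sat (F : CNFFormula V) (x : V → Bool) : Prop :=
  ∀ C ∈ F.clauses, ∃ l ∈ C, l.Holds x

/-- The variables occurring in the formula. -/
def vars (F : CNFFormula V) : Set V :=
  {v | ∃ C ∈ F.clauses, ∃ l ∈ C, l.var = v}

/-- The number of variables of the formula. -/
noncomputable def numVars (F : CNFFormula V) : ℕ := F.vars.ncard

/-- The primal graph: two distinct variables are adjacent if they occur in a common clause. -/
def primalGraph (F : CNFFormula V) : SimpleGraph V :=
  SimpleGraph.fromRel fun u v => ∃ C ∈ F.clauses, (∃ l ∈ C, l.var = u) ∧ ∃ l ∈ C, l.var = v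

end CNFFormula

/-- The monotone 2-CNF `φ(G)`: its variables are the vertices of `G` and its clauses are the
`(u ∨ v)` for the edges `{u, v}` of `G`. -/
def SimpleGraph.monotoneCNF {V : Type*} (G : SimpleGraph V) : CNFFormula V where
  clauses := {C | ∃ u v : V, G.Adj u v ∧ C = {⟨u, true⟩, ⟨v, true⟩}}

/-! ### Nondeterministic read-once branching programs -/

/-- `IsDiPath tail head a es b`: the list `es` of edges is the sequence of edges of a directed
walk from `a` to `b`. (In an acyclic graph, every directed walk is a directed path.) -/
inductive IsDiPath {N E : Type*} (tail head : E → N) : N → List E → N → Prop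
  | nil (a : N) : IsDiPath tail head a [] a
  | cons (e : E) (es : List E) (b : N) (h : IsDiPath tail head (head e) es b) :
      IsDiPath tail head (tail e) (e :: es) b

/-- A nondeterministic (syntactic) read-once branching program over the variables `V`, with nodes
`N` and edges `E`: a directed acyclic graph, possibly with multiple edges, with exactly one root
(source) and exactly one leaf (sink), some of whose edges are labelled by literals, such that no
directed path has two edges labelled by literals of the same variable. -/
structure NROBP (V N E : Type*) where
  /-- the node where an edge starts -/
  tail : E → N
  /-- the node where an edge ends -/
  head : E → N
  /-- the label of an edge, if any -/
  label : E → Option (BoolLiteral V)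
  acyclic : ∀ (a : N) (es : List E), IsDiPath tail head a es a → es = []
  root : N
  root_iff : ∀ a : N, (∀ e : E, head e ≠ a) ↔ a = root
  leaf : N
  leaf_iff : ∀ a : N, (∀ e : E, tail e ≠ a) ↔ a = leaf
  readOnce : ∀ (a b : N) (es : List E), IsDiPath tail head a es b →
    ((es.filterMap label).map BoolLiteral.var).Nodup

/-- `x` makes every literal labelling an edge of the path `es` true, that is, `A(P) ⊆ x`. -/
def NROBP.Consistent {V N E : Type*} (Y : NROBP V N E) (es : List E) (x : V → Bool) : Prop :=
  ∀ l ∈ es.filterMap Y.label, l.Holds x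

/-- `Y` computes the Boolean function `F`: all assignments extending the literals of a root-leaf
path satisfy `F`, and every satisfying assignment of `F` extends the literals of some root-leaf
path. -/
def NROBP.Computes {V N E : Type*} (Y : NROBP V N E) (F : (V → Bool) → Prop) : Prop :=
  (∀ es : List E, IsDiPath Y.tail Y.head Y.root es Y.leaf → ∀ x, Y.Consistent es x → F x) ∧
  (∀ x, F x → ∃ es : List E, IsDiPath Y.tail Y.head Y.root es Y.leaf ∧ Y.Consistent es x)

/-! The graphs are strips: the product of a complete ternary tree of height `2 * p + s` with a path
on `p` vertices, where `p` is about `k / 2`. Bags made of two adjacent copies of the path give width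
at most `2 * p - 1`. For `s ≥ 2 * p` the number `n` of vertices satisfies `log n = O(s)`, so a bound
exponential in `p * s` is a bound `n ^ Ω(k)`.

The bound comes from cuts. Along a root-leaf path of a read-once program, the variables that can no
longer be read form a growing chain of sets. Refining the chain to a vertex order,
`exists_threshold` yields a prefix `Z` whose cut needs `p * s` vertices to cover. Some edge of the
path separates `Z` from its complement, in the sense of `Compatible`, and the satisfying assignments
passing its two end nodes form at most two rectangles across `Z`.

In such a rectangle of vertex covers, each cut edge has an endpoint that belongs to every cover of
the rectangle; so at least `p * s` vertices are common to all of them. In a graph of degree at most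
`d`, requiring a further vertex cuts the number of covers by a factor of at least `(2 ^ d + 1) / 2 ^
d` (`card_coversContaining_insert_le`), so a rectangle holds an exponentially small share of all
covers. A union bound over pairs of adjacent nodes (`pow_le_card_pairs`) finishes. -/

/-! ### Counting vertex covers -/

/-- The satisfying assignments of `φ(G)` are the vertex covers of `G`. -/
theorem SimpleGraph.monotoneCNF_sat_iff {V : Type*} (G : SimpleGraph V) (x : V → Bool) :
    G.monotoneCNF.Sat x ↔ ∀ u v, G.Adj u v → x u = true ∨ x v = true := by
  constructor
  · intro h u v huv
    obtain ⟨l, hl, hx⟩ := h _ ⟨u, v, huv, rfl⟩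
    rcases hl with rfl | hl
    · exact Or.inl hx
    · rw [Set.mem_singleton_iff] at hl
      subst hl
      exact Or.inr hx
  · rintro h C ⟨u, v, huv, rfl⟩
    rcases h u v huv with hu | hv
    · exact ⟨⟨u, true⟩, Or.inl rfl, hu⟩
    · exact ⟨⟨v, true⟩, Or.inr rfl, hv⟩

open Classical in
/-- The vertex covers of `G` (as indicator functions) containing the set `W`. -/
noncomputable def SimpleGraph.coversContaining {V : Type*} [Fintype V] (G : SimpleGraph V)
    (W : Finset V) : Finset (V → Bool) :=
  Finset.univ.filter fun x =>
    (∀ u v, G.Adj u v → x u = true ∨ x v = true) ∧ ∀ w ∈ W, x w = true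

theorem SimpleGraph.mem_coversContaining {V : Type*} [Fintype V] {G : SimpleGraph V}
    {W : Finset V} {x : V → Bool} :
    x ∈ G.coversContaining W ↔
      (∀ u v, G.Adj u v → x u = true ∨ x v = true) ∧ ∀ w ∈ W, x w = true := by
  simp [SimpleGraph.coversContaining]

-- Switch `v` off and all of `A`, hence all neighbours of `v`, on: this sends covers containing
-- `insert v W` to covers containing `W` but not `v`. Only the values on `A` are forgotten, so
-- fibres have at most `2 ^ d` elements.
open Classical in
theorem SimpleGraph.card_coversContaining_insert_le {V : Type*} [Fintype V] (G : SimpleGraph V)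
    {d : ℕ} (hd : ∀ v, ∃ A : Finset V, A.card ≤ d ∧ ∀ w, G.Adj v w → w ∈ A)
    (W : Finset V) {v : V} (hv : v ∉ W) :
    (G.coversContaining (insert v W)).card * (2 ^ d + 1) ≤
      2 ^ d * (G.coversContaining W).card := by
  obtain ⟨A, hA, hadj⟩ := hd v
  have hsub : G.coversContaining (insert v W) ⊆ G.coversContaining W := by
    intro x hx
    rw [mem_coversContaining] at hx ⊢
    exact ⟨hx.1, fun w hw => hx.2 w (Finset.mem_insert_of_mem hw)⟩
  have key : (G.coversContaining (insert v W)).card ≤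
      2 ^ d * (G.coversContaining W \ G.coversContaining (insert v W)).card := by
    apply Finset.card_le_mul_card_image_of_maps_to
      (f := fun x w => if w = v then false else if w ∈ A then true else x w)
    · intro x hx
      rw [mem_coversContaining] at hx
      rw [Finset.mem_sdiff, mem_coversContaining, mem_coversContaining]
      refine ⟨⟨fun a b hab => ?_, fun w hw => ?_⟩, fun h => ?_⟩
      · by_cases ha : a = v
        · subst ha
          right
          simp [hab.ne', hadj b hab]
        · by_cases hb : b = v
          · subst hb
            left
            simp [ha, hadj a hab.symm]
          · simp only [ha, hb, if_false]
            rcases hx.1 a b hab with h | h <;> simp [h]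
      · have : w ≠ v := fun h => hv (h ▸ hw)
        simp [this, hx.2 w (Finset.mem_insert_of_mem hw)]
      · simpa using h.2 v (Finset.mem_insert_self _ _)
    · intro y _
      calc _ ≤ (Finset.univ : Finset (A → Bool)).card := by
            apply Finset.card_le_card_of_injOn (fun (x : V → Bool) (a : A) => x a)
              (fun _ _ => Finset.mem_coe.2 (Finset.mem_univ _))
            intro x hx x' hx' hxx
            simp only [Finset.coe_filter, Set.mem_ofPred_eq, mem_coversContaining] at hx hx'
            funext w
            by_cases hw : w = v
            · subst hw
              rw [hx.1.2 _ (Finset.mem_insert_self _ _), hx'.1.2 _ (Finset.mem_insert_self _ _)]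
            · by_cases hwA : w ∈ A
              · exact congrFun hxx ⟨w, hwA⟩
              · have := congrFun (hx.2.trans hx'.2.symm) w
                simpa [hw, hwA] using this
        _ = 2 ^ A.card := by simp
        _ ≤ 2 ^ d := Nat.pow_le_pow_right (by norm_num) hA
  rw [Finset.card_sdiff_of_subset hsub, Nat.mul_sub] at key
  have := Nat.mul_le_mul_left (2 ^ d) (Finset.card_le_card hsub)
  rw [mul_add, mul_one, mul_comm]
  omega

theorem SimpleGraph.card_coversContaining_le {V : Type*} [Fintype V] (G : SimpleGraph V)
    {d : ℕ} (hd : ∀ v, ∃ A : Finset V, A.card ≤ d ∧ ∀ w, G.Adj v w → w ∈ A) (W : Finset V) :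
    (G.coversContaining W).card * (2 ^ d + 1) ^ W.card ≤
      (2 ^ d) ^ W.card * (G.coversContaining ∅).card := by
  classical
  induction W using Finset.induction_on with
  | empty => simp
  | insert v W hv ih =>
    rw [Finset.card_insert_of_notMem hv]
    calc _ = (G.coversContaining (insert v W)).card * (2 ^ d + 1) * (2 ^ d + 1) ^ W.card := by ring
      _ ≤ 2 ^ d * (G.coversContaining W).card * (2 ^ d + 1) ^ W.card :=
        Nat.mul_le_mul_right _ (G.card_coversContaining_insert_le hd W hv)
      _ = 2 ^ d * ((G.coversContaining W).card * (2 ^ d + 1) ^ W.card) := by ring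
      _ ≤ 2 ^ d * ((2 ^ d) ^ W.card * (G.coversContaining ∅).card) := Nat.mul_le_mul_left _ ih
      _ = _ := by ring

/-! ### Cuts and rectangles of vertex covers -/

/-- Every vertex cover of the bipartite graph of edges between `Z` and its complement has at least
`t` elements. -/
def SimpleGraph.CutCover {V : Type*} (G : SimpleGraph V) (Z : Set V) (t : ℕ) : Prop :=
  ∀ W : Finset V, (∀ u v, G.Adj u v → u ∈ Z → v ∉ Z → u ∈ W ∨ v ∈ W) → t ≤ W.card

open Classical in
/-- A family of assignments such that combining two of them along the cut `Z` always gives a vertex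
cover is small. -/
theorem SimpleGraph.CutCover.card_le {V : Type*} [Fintype V] {G : SimpleGraph V}
    {d : ℕ} (hd : ∀ v, ∃ A : Finset V, A.card ≤ d ∧ ∀ w, G.Adj v w → w ∈ A)
    {Z : Set V} {t : ℕ} (hZ : G.CutCover Z t) (R : Finset (V → Bool))
    (hR : R ⊆ G.coversContaining ∅)
    (hmix : ∀ x ∈ R, ∀ y ∈ R, ∀ u v, G.Adj u v → u ∈ Z → v ∉ Z → x u = true ∨ y v = true) :
    R.card * (2 ^ d + 1) ^ t ≤ (2 ^ d) ^ t * (G.coversContaining ∅).card := by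
  -- If neither end of a cut edge were in `W`, an `x ∈ R` missing `u` and a `y ∈ R` missing `v`
  -- would combine to a non-cover. So `W` covers the cut.
  set W : Finset V := Finset.univ.filter fun w => ∀ x ∈ R, x w = true with hW
  have ht : t ≤ W.card := by
    apply hZ
    intro u v huv hu hv
    by_contra! h
    simp only [hW, Finset.mem_filter, Finset.mem_univ, true_and] at h
    push Not at h
    obtain ⟨⟨x, hx, hxu⟩, y, hy, hyv⟩ := h
    rcases hmix x hx y hy u v huv hu hv with h | h
    · exact hxu h
    · exact hyv h
  obtain ⟨W', hW', rfl⟩ := Finset.exists_subset_card_eq ht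
  refine le_trans (Nat.mul_le_mul_right _ (Finset.card_le_card fun x hx => ?_))
    (G.card_coversContaining_le hd W')
  rw [mem_coversContaining]
  refine ⟨(mem_coversContaining.1 (hR hx)).1, fun w hw => ?_⟩
  exact (Finset.mem_filter.1 (hW' hw)).2 x hx

/-! ### Paths in branching programs -/

theorem isDiPath_nil_iff {N E : Type*} {tail head : E → N} {a b : N} :
    IsDiPath tail head a [] b ↔ a = b := by
  constructor
  · intro h
    cases h
    rfl
  · rintro rfl
    exact .nil _

theorem isDiPath_cons_iff {N E : Type*} {tail head : E → N} {a b : N} {e : E} {es : List E} :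
    IsDiPath tail head a (e :: es) b ↔ a = tail e ∧ IsDiPath tail head (head e) es b := by
  constructor
  · intro h
    cases h with
    | cons _ _ _ h => exact ⟨rfl, h⟩
  · rintro ⟨rfl, h⟩
    exact .cons _ _ _ h

theorem IsDiPath.append {N E : Type*} {tail head : E → N} {a b c : N} {es fs : List E}
    (h : IsDiPath tail head a es b) (h' : IsDiPath tail head b fs c) :
    IsDiPath tail head a (es ++ fs) c := by
  induction h with
  | nil => exact h'
  | cons e es b _ ih => exact .cons e _ _ (ih h')

theorem IsDiPath.exists_split {N E : Type*} {tail head : E → N} {a b : N} {es : List E}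
    (h : IsDiPath tail head a es b) {e : E} (he : e ∈ es) :
    ∃ fs gs, es = fs ++ e :: gs ∧ IsDiPath tail head a fs (tail e) ∧
      IsDiPath tail head (head e) gs b := by
  induction h with
  | nil => simp at he
  | cons e' es b h ih =>
    rcases List.mem_cons.1 he with rfl | he
    · exact ⟨[], es, rfl, .nil _, h⟩
    · obtain ⟨fs, gs, rfl, h1, h2⟩ := ih he
      exact ⟨e' :: fs, gs, rfl, .cons _ _ _ h1, h2⟩

namespace NROBP

variable {V N E : Type*} (Y : NROBP V N E)

/-- The variables read on the edges of a list. -/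
def readVars (es : List E) : Set V := {v | ∃ l ∈ es.filterMap Y.label, l.var = v}

/-- The variables read on paths from the root to `a`. -/
def before (a : N) : Set V :=
  {v | ∃ es, IsDiPath Y.tail Y.head Y.root es a ∧ v ∈ Y.readVars es}

/-- The variables read on paths from `a` to the leaf. -/
def after (a : N) : Set V :=
  {v | ∃ es, IsDiPath Y.tail Y.head a es Y.leaf ∧ v ∈ Y.readVars es}

variable {Y}

theorem disjoint_before_after {a : N} {v : V} (h : v ∈ Y.before a) : v ∉ Y.after a := by
  rintro ⟨fs, hfs, l', hl', rfl⟩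
  obtain ⟨es, hes, l, hl, hll⟩ := h
  have := Y.readOnce _ _ _ (hes.append hfs)
  rw [List.filterMap_append, List.map_append, List.nodup_append] at this
  exact this.2.2 _ (List.mem_map_of_mem hl) _ (List.mem_map_of_mem hl') hll

theorem after_head_subset (e : E) : Y.after (Y.head e) ⊆ Y.after (Y.tail e) := by
  rintro v ⟨es, hes, l, hl, rfl⟩
  refine ⟨e :: es, .cons _ _ _ hes, l, ?_, rfl⟩
  rw [List.filterMap_cons]
  cases Y.label e with
  | none => exact hl
  | some => exact List.mem_cons_of_mem _ hl

theorem before_root : Y.before Y.root = ∅ := by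
  ext v
  simp only [Set.mem_empty_iff_false, iff_false]
  rintro ⟨es, hes, hv⟩
  suffices ∀ a b es, IsDiPath Y.tail Y.head a es b → es ≠ [] → ∃ e, Y.head e = b by
    obtain rfl | hne := eq_or_ne es []
    · obtain ⟨l, hl, -⟩ := hv
      simp at hl
    · obtain ⟨e, he⟩ := this _ _ _ hes hne
      exact (Y.root_iff Y.root).2 rfl e he
  intro a b es h
  induction h with
  | nil => simp
  | cons e es b h ih =>
    intro _
    obtain rfl | hne := eq_or_ne es []
    · exact ⟨e, isDiPath_nil_iff.1 h⟩
    · exact ih hne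

theorem after_leaf : Y.after Y.leaf = ∅ := by
  ext v
  simp only [Set.mem_empty_iff_false, iff_false]
  rintro ⟨es, hes, l, hl, -⟩
  cases es with
  | nil => simp at hl
  | cons e es => exact (Y.leaf_iff Y.leaf).2 rfl e (isDiPath_cons_iff.1 hes).1.symm

/-- On a path, the sets of variables still to be read are decreasing. -/
theorem after_chain {a b : N} {es : List E} (h : IsDiPath Y.tail Y.head a es b) :
    (∀ e ∈ es, Y.after (Y.tail e) ⊆ Y.after a) ∧
    ∀ e ∈ es, ∀ e' ∈ es, Y.after (Y.tail e) ⊆ Y.after (Y.tail e') ∨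
      Y.after (Y.tail e') ⊆ Y.after (Y.tail e) := by
  induction h with
  | nil => simp
  | cons e es b h ih =>
    have h1 : ∀ e' ∈ es, Y.after (Y.tail e') ⊆ Y.after (Y.tail e) :=
      fun e' he' => (ih.1 e' he').trans (after_head_subset e)
    refine ⟨fun e' he' => ?_, fun e₁ he₁ e₂ he₂ => ?_⟩
    · rcases List.mem_cons.1 he' with rfl | he'
      · exact subset_rfl
      · exact h1 e' he'
    · rcases List.mem_cons.1 he₁ with rfl | he₁ <;> rcases List.mem_cons.1 he₂ with h₂ | he₂
      · exact Or.inl (by rw [h₂])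
      · exact Or.inr (h1 _ he₂)
      · exact Or.inl (h₂ ▸ h1 _ he₁)
      · exact ih.2 _ he₁ _ he₂

/-- The cut `Z` separates `a` from `b`: nothing outside `Z` is read before `a`, and nothing inside
`Z` is read after `b`. -/
def Compatible (Y : NROBP V N E) (a b : N) (Z : Set V) : Prop :=
  Y.before a ⊆ Z ∧ ∀ v ∈ Z, v ∉ Y.after b

/-- Walk along the path keeping `Y.before a ⊆ Z`. Either `Z` avoids everything read from the next
node on, and the current edge works, or `Z` contains all that is not read from there; by
read-onceness this includes all that was read before, and the walk goes on. -/
theorem exists_compatible {a b : N} {es : List E} (h : IsDiPath Y.tail Y.head a es b)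
    (hes : es ≠ []) {Z : Set V} (ha : Y.before a ⊆ Z) (hb : ∀ v ∈ Z, v ∉ Y.after b)
    (hcmp : ∀ e ∈ es, Z ⊆ (Y.after (Y.tail e))ᶜ ∨ (Y.after (Y.tail e))ᶜ ⊆ Z) :
    ∃ e ∈ es, Y.Compatible (Y.tail e) (Y.head e) Z := by
  induction es generalizing a with
  | nil => simp at hes
  | cons e es ih =>
    obtain ⟨rfl, h'⟩ := isDiPath_cons_iff.1 h
    cases es with
    | nil =>
      obtain rfl := isDiPath_nil_iff.1 h'
      exact ⟨e, by simp, ha, hb⟩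
    | cons e' es =>
      have hee := (isDiPath_cons_iff.1 h').1
      rcases hcmp e' (by simp) with hZ | hZ
      · exact ⟨e, by simp, ha, fun v hv => hee ▸ hZ hv⟩
      · obtain ⟨e₀, he₀, h₀⟩ := ih h' (by simp)
          (fun v hv => hZ (hee ▸ disjoint_before_after hv))
          (fun e he => hcmp e (List.mem_cons_of_mem _ he))
        exact ⟨e₀, List.mem_cons_of_mem _ he₀, h₀⟩

/-- The assignment `x` is consistent with a root-leaf path using an edge from `a` to `b`
whose label satisfies `P`. -/
def Passes (Y : NROBP V N E) (a b : N) (P : Option (BoolLiteral V) → Prop) (x : V → Bool) : Prop :=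
  ∃ es e fs, Y.tail e = a ∧ Y.head e = b ∧ P (Y.label e) ∧
    IsDiPath Y.tail Y.head Y.root es a ∧ IsDiPath Y.tail Y.head b fs Y.leaf ∧
    Y.Consistent (es ++ e :: fs) x

theorem consistent_append_cons {es fs : List E} {e : E} {x : V → Bool} :
    Y.Consistent (es ++ e :: fs) x ↔
      Y.Consistent es x ∧ (∀ l ∈ Y.label e, l.Holds x) ∧ Y.Consistent fs x := by
  simp only [Consistent, List.filterMap_append, List.filterMap_cons, List.mem_append]
  cases h : Y.label e <;> simp [or_imp, forall_and]

theorem Consistent.congr {es : List E} {x y : V → Bool} (h : Y.Consistent es x)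
    (hxy : ∀ v ∈ Y.readVars es, x v = y v) : Y.Consistent es y := by
  intro l hl
  have := h l hl
  unfold BoolLiteral.Holds at *
  rw [← this, hxy _ ⟨l, hl, rfl⟩]

/-- If the variable labelling the connecting edge lies in the cut side given by `P`, the passing
assignments form a rectangle. -/
theorem Passes.mix {a b : N} {Z : Set V} (hZ : Y.Compatible a b Z) {F : (V → Bool) → Prop}
    (hY : Y.Computes F) {P : Option (BoolLiteral V) → Prop}
    (hP : (∀ o, P o → ∀ l ∈ o, l.var ∈ Z) ∨ (∀ o, P o → ∀ l ∈ o, l.var ∉ Z))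
    {x y z : V → Bool} (hx : Y.Passes a b P x) (hy : Y.Passes a b P y)
    (hzx : ∀ v ∈ Z, x v = z v) (hzy : ∀ v ∉ Z, y v = z v) : F z := by
  obtain ⟨es, e, fs, rfl, rfl, he, hes, hfs, hc⟩ := hx
  obtain ⟨es', e', fs', ht, hh, he', hes', hfs', hc'⟩ := hy
  rw [consistent_append_cons] at hc hc'
  have h1 : Y.Consistent es z := hc.1.congr fun v hv => hzx v (hZ.1 ⟨es, hes, hv⟩)
  have h3 : Y.Consistent fs' z :=
    hc'.2.2.congr fun v hv => hzy v fun hvZ => hZ.2 v hvZ ⟨fs', hfs', hv⟩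
  -- The connecting edge is taken from the path of whichever assignment agrees with `z` on its
  -- label.
  rcases hP with hP | hP
  · refine hY.1 (es ++ e :: fs') (hes.append (.cons _ _ _ hfs')) z
      (consistent_append_cons.2 ⟨h1, fun l hl => ?_, h3⟩)
    have := hc.2.1 l hl
    unfold BoolLiteral.Holds at *
    rw [← this, hzx _ (hP _ he l hl)]
  · rw [← ht] at hes
    rw [← hh] at hfs'
    refine hY.1 (es ++ e' :: fs') (hes.append (.cons _ _ _ hfs')) z
      (consistent_append_cons.2 ⟨h1, fun l hl => ?_, h3⟩)
    have := hc'.2.1 l hl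
    unfold BoolLiteral.Holds at *
    rw [← this, hzy _ (hP _ he' l hl)]

-- The factor 2 arises because parallel edges between `a` and `b` may read variables on either side
-- of `Z`; each of the two kinds gives a rectangle, unlabelled edges belonging to both.
open Classical in
theorem card_passes_le [Fintype V] {G : SimpleGraph V} (hY : Y.Computes G.monotoneCNF.Sat)
    {d : ℕ} (hd : ∀ v, ∃ A : Finset V, A.card ≤ d ∧ ∀ w, G.Adj v w → w ∈ A)
    {a b : N} {Z : Set V} (hZ : Y.Compatible a b Z) {t : ℕ} (ht : G.CutCover Z t) :
    (Finset.univ.filter (Y.Passes a b fun _ => True)).card * (2 ^ d + 1) ^ t ≤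
      2 * ((2 ^ d) ^ t * (G.coversContaining ∅).card) := by
  have key : ∀ P : Option (BoolLiteral V) → Prop,
      ((∀ o, P o → ∀ l ∈ o, l.var ∈ Z) ∨ (∀ o, P o → ∀ l ∈ o, l.var ∉ Z)) →
      (Finset.univ.filter (Y.Passes a b P)).card * (2 ^ d + 1) ^ t ≤
        (2 ^ d) ^ t * (G.coversContaining ∅).card := by
    intro P hP
    apply ht.card_le hd
    · intro x hx
      rw [SimpleGraph.mem_coversContaining]
      have hx := (Finset.mem_filter.1 hx).2
      refine ⟨(G.monotoneCNF_sat_iff x).1 (hx.mix hZ hY hP hx ?_ ?_), by simp⟩ <;> simp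
    · intro x hx y hy u v huv hu hv
      have hx := (Finset.mem_filter.1 hx).2
      have hy := (Finset.mem_filter.1 hy).2
      have := (G.monotoneCNF_sat_iff _).1 (hx.mix hZ hY hP hy
        (z := fun v => if v ∈ Z then x v else y v) (by simp +contextual) (by simp +contextual))
        u v huv
      simpa [hu, hv] using this
  have hsub : Finset.univ.filter (Y.Passes a b fun _ => True) ⊆
      Finset.univ.filter (Y.Passes a b fun o => ∀ l ∈ o, l.var ∈ Z) ∪
      Finset.univ.filter (Y.Passes a b fun o => ∀ l ∈ o, l.var ∉ Z) := by
    intro x hx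
    obtain ⟨es, e, fs, h1, h2, -, h⟩ := (Finset.mem_filter.1 hx).2
    rw [Finset.mem_union, Finset.mem_filter, Finset.mem_filter]
    by_cases hl : ∀ l ∈ Y.label e, l.var ∈ Z
    · exact Or.inl ⟨Finset.mem_univ _, es, e, fs, h1, h2, hl, h⟩
    · push Not at hl
      obtain ⟨l, hl, hlZ⟩ := hl
      refine Or.inr ⟨Finset.mem_univ _, es, e, fs, h1, h2, fun l' hl' => ?_, h⟩
      rwa [Option.mem_unique hl' hl]
  calc _ ≤ _ := Nat.mul_le_mul_right _ ((Finset.card_le_card hsub).trans (Finset.card_union_le _ _))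
    _ ≤ _ := by
      have h1 := key (fun o => ∀ l ∈ o, l.var ∈ Z) (Or.inl fun _ h => h)
      have h2 := key (fun o => ∀ l ∈ o, l.var ∉ Z) (Or.inr fun _ h => h)
      rw [add_mul, two_mul]
      exact add_le_add h1 h2

open Classical in
/-- The lower bound on the number of pairs of adjacent nodes, from a lower bound on the cuts
compatible with chains of sets. -/
theorem pow_le_card_pairs [Fintype V] [Fintype E] {G : SimpleGraph V}
    (hY : Y.Computes G.monotoneCNF.Sat) (hG : ∃ u v, G.Adj u v)
    {d : ℕ} (hd : ∀ v, ∃ A : Finset V, A.card ≤ d ∧ ∀ w, G.Adj v w → w ∈ A) {t : ℕ}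
    (hcut : ∀ 𝒞 : Set (Set V), IsChain (· ⊆ ·) 𝒞 →
      ∃ Z, (∀ C ∈ 𝒞, Z ⊆ C ∨ C ⊆ Z) ∧ G.CutCover Z t) :
    (2 ^ d + 1) ^ t ≤
      2 * (Finset.univ.image fun e : E => (Y.tail e, Y.head e)).card * (2 ^ d) ^ t := by
  set Q := Finset.univ.image fun e : E => (Y.tail e, Y.head e) with hQ
  set S := G.coversContaining ∅ with hS
  have hSpos : 0 < S.card :=
    Finset.card_pos.2 ⟨fun _ => true, SimpleGraph.mem_coversContaining.2 (by simp)⟩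
  -- The cut `Z` is allowed to depend on the pair: the union bound only needs each pair to have some
  -- good cut.
  set Q' := Q.filter fun q => ∃ Z, Y.Compatible q.1 q.2 Z ∧ G.CutCover Z t with hQ'
  have hcov : S ⊆ Q'.biUnion fun q =>
      Finset.univ.filter (Y.Passes q.1 q.2 fun _ => True) := by
    intro x hx
    obtain ⟨es, hes, hc⟩ := hY.2 x
      ((G.monotoneCNF_sat_iff x).2 (SimpleGraph.mem_coversContaining.1 hx).1)
    have hne : es ≠ [] := by
      rintro rfl
      obtain ⟨u, v, huv⟩ := hG
      have := (G.monotoneCNF_sat_iff _).1 (hY.1 [] hes (fun _ => false) (by simp [Consistent])) u v huv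
      simp at this
    obtain ⟨Z, hZ, hZt⟩ := hcut {C | ∃ e ∈ es, C = (Y.after (Y.tail e))ᶜ} (by
      rintro _ ⟨e, he, rfl⟩ _ ⟨e', he', rfl⟩ -
      simp only [Set.compl_subset_compl]
      exact ((after_chain hes).2 e he e' he').symm)
    obtain ⟨e, he, hcomp⟩ := exists_compatible hes hne (Z := Z) (by simp [before_root])
      (by simp [after_leaf]) fun e he => hZ _ ⟨e, he, rfl⟩
    obtain ⟨fs, gs, rfl, h1, h2⟩ := hes.exists_split he
    rw [Finset.mem_biUnion]
    refine ⟨(Y.tail e, Y.head e), Finset.mem_filter.2 ⟨?_, Z, hcomp, hZt⟩, ?_⟩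
    · exact Finset.mem_image_of_mem _ (Finset.mem_univ _)
    · exact Finset.mem_filter.2 ⟨Finset.mem_univ _, fs, e, gs, rfl, rfl, trivial, h1, h2, hc⟩
  have : S.card * (2 ^ d + 1) ^ t ≤ S.card * (2 * Q.card * (2 ^ d) ^ t) := by
    calc S.card * (2 ^ d + 1) ^ t
      _ ≤ (∑ q ∈ Q', (Finset.univ.filter (Y.Passes q.1 q.2 fun _ => True)).card) *
            (2 ^ d + 1) ^ t :=
          Nat.mul_le_mul_right _ ((Finset.card_le_card hcov).trans Finset.card_biUnion_le)
      _ ≤ ∑ _q ∈ Q', 2 * ((2 ^ d) ^ t * S.card) := by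
          rw [Finset.sum_mul]
          refine Finset.sum_le_sum fun q hq => ?_
          obtain ⟨Z, hZ, hZt⟩ := (Finset.mem_filter.1 hq).2
          exact card_passes_le hY hd hZ hZt
      _ = Q'.card * (2 * ((2 ^ d) ^ t * S.card)) := by rw [Finset.sum_const, smul_eq_mul]
      _ ≤ Q.card * (2 * ((2 ^ d) ^ t * S.card)) :=
          Nat.mul_le_mul_right _ (Finset.card_le_card (Finset.filter_subset _ _))
      _ = _ := by ring
  exact Nat.le_of_mul_le_mul_left this hSpos

end NROBP

/-! ### Strips of ternary trees -/

/-- The Cartesian product of the infinite ternary tree (of words over `Fin 3`) and an infinite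
path. -/
def ternaryStrip : SimpleGraph (List (Fin 3) × ℕ) where
  Adj x y := (x.1 = y.1 ∧ (y.2 = x.2 + 1 ∨ x.2 = y.2 + 1)) ∨
    (x.2 = y.2 ∧ ((∃ i, y.1 = x.1 ++ [i]) ∨ ∃ i, x.1 = y.1 ++ [i]))
  symm := ⟨by
    rintro x y (⟨h, h'⟩ | ⟨h, h'⟩)
    · exact Or.inl ⟨h.symm, h'.symm⟩
    · exact Or.inr ⟨h.symm, h'.symm⟩⟩
  loopless := ⟨by
    rintro x (⟨-, h⟩ | ⟨-, ⟨i, h⟩ | ⟨i, h⟩⟩)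
    · omega
    · simp at h
    · simp at h⟩

theorem ternaryStrip_adj_cons_iff {i : Fin 3} {l l' : List (Fin 3)} {h h' : ℕ} :
    ternaryStrip.Adj (i :: l, h) (i :: l', h') ↔ ternaryStrip.Adj (l, h) (l', h') := by
  simp [ternaryStrip]

theorem ternaryStrip_adj_succ (l : List (Fin 3)) (h : ℕ) :
    ternaryStrip.Adj (l, h) (l, h + 1) :=
  Or.inl ⟨rfl, Or.inl rfl⟩

theorem ternaryStrip_adj_append (l : List (Fin 3)) (i : Fin 3) (h : ℕ) :
    ternaryStrip.Adj (l, h) (l ++ [i], h) :=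
  Or.inr ⟨rfl, Or.inl ⟨i, rfl⟩⟩

/-- The words of length at most `r`. -/
def ternaryWords : ℕ → Finset (List (Fin 3))
  | 0 => {[]}
  | r + 1 => insert [] ((Finset.univ ×ˢ ternaryWords r).image fun q => q.1 :: q.2)

theorem mem_ternaryWords {r : ℕ} {l : List (Fin 3)} : l ∈ ternaryWords r ↔ l.length ≤ r := by
  induction r generalizing l with
  | zero => simp [ternaryWords]
  | succ r ih =>
    cases l with
    | nil => simp [ternaryWords]
    | cons i l => simp [ternaryWords, ih]

theorem card_ternaryWords_le (r : ℕ) : (ternaryWords r).card ≤ 4 ^ r := by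
  induction r with
  | zero => simp [ternaryWords]
  | succ r ih =>
    have h1 := Finset.card_insert_le []
      ((Finset.univ ×ˢ ternaryWords r).image fun q : Fin 3 × List (Fin 3) => q.1 :: q.2)
    have h2 := Finset.card_image_le (s := Finset.univ ×ˢ ternaryWords r)
      (f := fun q : Fin 3 × List (Fin 3) => q.1 :: q.2)
    rw [Finset.card_product, Finset.card_univ, Fintype.card_fin] at h2
    have h3 : 1 ≤ 4 ^ r := Nat.one_le_pow _ _ (by norm_num)
    rw [ternaryWords, pow_succ]
    omega

theorem lt_card_ternaryWords (r : ℕ) : r < (ternaryWords r).card := by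
  have : ((Finset.range (r + 1)).image fun n => List.replicate n (0 : Fin 3)).card ≤
      (ternaryWords r).card := by
    apply Finset.card_le_card
    intro l hl
    obtain ⟨n, hn, rfl⟩ := Finset.mem_image.1 hl
    rw [mem_ternaryWords, List.length_replicate]
    exact Nat.lt_succ_iff.1 (Finset.mem_range.1 hn)
  rw [Finset.card_image_of_injective _ (fun a b h => by simpa using congrArg List.length h),
    Finset.card_range] at this
  exact this

/-- The vertices of the strip of height `r` and width `p`. -/
def ternaryBox (r p : ℕ) : Finset (List (Fin 3) × ℕ) := ternaryWords r ×ˢ Finset.range p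

theorem mem_ternaryBox {r p : ℕ} {x : List (Fin 3) × ℕ} :
    x ∈ ternaryBox r p ↔ x.1.length ≤ r ∧ x.2 < p := by
  rw [ternaryBox, Finset.mem_product, mem_ternaryWords, Finset.mem_range]

/-- In a product of a connected set of words and a path of length `p`, a cut with at least `p ^ 2`
vertices on both sides has cover number at least `p`. -/
theorem le_card_cover_of_sq_le {p : ℕ} {L : Finset (List (Fin 3))}
    (hL : ∀ l i, l ++ [i] ∈ L → l ∈ L) {c : List (Fin 3) × ℕ → Prop} [DecidablePred c]
    (h1 : p ^ 2 ≤ ((L ×ˢ Finset.range p).filter fun x => c x).card)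
    (h2 : p ^ 2 ≤ ((L ×ˢ Finset.range p).filter fun x => ¬ c x).card)
    {W : Finset (List (Fin 3) × ℕ)}
    (hW : ∀ x ∈ L ×ˢ Finset.range p, ∀ y ∈ L ×ˢ Finset.range p,
      ternaryStrip.Adj x y → c x → ¬ c y → x ∈ W ∨ y ∈ W) : p ≤ W.card := by
  by_contra! hlt
  have hsame : ∀ x ∈ L ×ˢ Finset.range p, ∀ y ∈ L ×ˢ Finset.range p,
      ternaryStrip.Adj x y → x ∉ W → y ∉ W → (c x ↔ c y) := by
    intro x hx y hy hxy hxW hyW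
    by_contra h
    by_cases hcx : c x
    · rcases hW x hx y hy hxy hcx (by tauto) with h | h <;> contradiction
    · rcases hW y hy x hx hxy.symm (by tauto) hcx with h | h <;> contradiction
  have hC : (W.image Prod.snd).card < p := Finset.card_image_le.trans_lt hlt
  have hD : (W.image Prod.fst).card < p := Finset.card_image_le.trans_lt hlt
  have hp : 0 < p := by omega
  have hLp : p ≤ L.card := by
    have := h1.trans (Finset.card_filter_le _ _)
    rw [Finset.card_product, Finset.card_range, sq] at this
    exact Nat.le_of_mul_le_mul_right this hp
  obtain ⟨h₀, hh₀, hh₀W⟩ : ∃ h ∈ Finset.range p, h ∉ W.image Prod.snd :=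
    Finset.exists_mem_notMem_of_card_lt_card (by simpa using hC)
  obtain ⟨l₀, hl₀, hl₀W⟩ : ∃ l ∈ L, l ∉ W.image Prod.fst :=
    Finset.exists_mem_notMem_of_card_lt_card (hD.trans_le hLp)
  -- A copy of the tree or of the path that avoids `W` lies on one side of the cut. Any free tree
  -- copy meets any free path copy, so all of them lie on the side of `(l₀, h₀)`, and the other side
  -- fits into the product of the two projections of `W`.
  have col : ∀ h < p, h ∉ W.image Prod.snd → ∀ l ∈ L, (c (l, h) ↔ c ([], h)) := by
    intro h hh hhW l
    have hn : ∀ l, (l, h) ∉ W := fun l hl => hhW (Finset.mem_image_of_mem Prod.snd hl)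
    induction l using List.reverseRecOn with
    | nil => simp
    | append_singleton l i ih =>
      intro hl
      have hl' := hL _ _ hl
      rw [← ih hl']
      exact (hsame _ (by simp [hl', hh]) _ (by simp [hl, hh]) (ternaryStrip_adj_append l i h)
        (hn _) (hn _)).symm
  have row : ∀ l ∈ L, l ∉ W.image Prod.fst → ∀ h < p, (c (l, h) ↔ c (l, 0)) := by
    intro l hl hlW h
    have hn : ∀ h, (l, h) ∉ W := fun h hh => hlW (Finset.mem_image_of_mem Prod.fst hh)
    induction h with
    | zero => simp
    | succ h ih =>
      intro hh
      rw [← ih (by omega)]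
      exact (hsame _ (by simp [hl]; omega) _ (by simp [hl]; omega) (ternaryStrip_adj_succ l h)
        (hn _) (hn _)).symm
  rw [Finset.mem_range] at hh₀
  have hsub : ∀ x ∈ L ×ˢ Finset.range p, ¬ (c x ↔ c (l₀, h₀)) →
      x ∈ W.image Prod.fst ×ˢ W.image Prod.snd := by
    rintro ⟨l, h⟩ hx hne
    rw [Finset.mem_product, Finset.mem_range] at hx
    rw [Finset.mem_product]
    constructor
    · by_contra hl
      exact hne ((row l hx.1 hl h hx.2).trans ((row l hx.1 hl h₀ hh₀).symm.trans
        ((col h₀ hh₀ hh₀W l hx.1).trans (col h₀ hh₀ hh₀W l₀ hl₀).symm)))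
    · by_contra hh
      exact hne ((col h hx.2 hh l hx.1).trans ((col h hx.2 hh l₀ hl₀).symm.trans
        ((row l₀ hl₀ hl₀W h hx.2).trans (row l₀ hl₀ hl₀W h₀ hh₀).symm)))
  have hlt2 : (W.image Prod.fst ×ˢ W.image Prod.snd).card < p ^ 2 := by
    rw [Finset.card_product, sq]
    exact Nat.mul_lt_mul'' hD hC
  by_cases hc : c (l₀, h₀)
  · refine absurd (h2.trans (Finset.card_le_card fun x hx => ?_)) (not_le.2 hlt2)
    rw [Finset.mem_filter] at hx
    exact hsub x hx.1 (by tauto)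
  · refine absurd (h1.trans (Finset.card_le_card fun x hx => ?_)) (not_le.2 hlt2)
    rw [Finset.mem_filter] at hx
    exact hsub x hx.1 (by tauto)

theorem exists_card_filter_lt_eq {α : Type*} [DecidableEq α] {B : Finset α} {f : α → ℕ}
    (hf : Set.InjOn f B) (m : ℕ) (hm : m ≤ B.card) :
    ∃ j, (B.filter fun x => f x < j).card = m := by
  induction m with
  | zero => exact ⟨0, by simp⟩
  | succ m ih =>
    obtain ⟨j, hj⟩ := ih (by omega)
    have hne : (B.filter fun x => ¬ f x < j).Nonempty := by
      rw [← Finset.card_pos]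
      have := Finset.card_filter_add_card_filter_not (s := B) (fun x => f x < j)
      omega
    obtain ⟨x, hx, hmin⟩ := Finset.exists_min_image _ f hne
    rw [Finset.mem_filter] at hx
    refine ⟨f x + 1, ?_⟩
    have : (B.filter fun y => f y < f x + 1) = insert x (B.filter fun y => f y < j) := by
      ext y
      simp only [Finset.mem_filter, Finset.mem_insert]
      constructor
      · rintro ⟨hy, hyx⟩
        by_cases hyj : f y < j
        · exact Or.inr ⟨hy, hyj⟩
        · have := hmin y (Finset.mem_filter.2 ⟨hy, hyj⟩)
          exact Or.inl (hf hy hx.1 (by omega))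
      · rintro (rfl | ⟨hy, hyj⟩)
        · exact ⟨hx.1, by omega⟩
        · exact ⟨hy, by omega⟩
    rw [this, Finset.card_insert_of_notMem (by simp [hx.2]), hj]

/-- Among three numbers there is a middle one. -/
theorem exists_median (j : Fin 3 → ℕ) :
    ∃ a b c, a ≠ b ∧ c ≠ b ∧ j a ≤ j b ∧ j b ≤ j c := by
  rcases le_total (j 0) (j 1) with h | h <;> rcases le_total (j 1) (j 2) with h' | h' <;>
    rcases le_total (j 0) (j 2) with h'' | h''
  · exact ⟨0, 1, 2, by decide, by decide, h, h'⟩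
  · exact ⟨0, 1, 2, by decide, by decide, h, h'⟩
  · exact ⟨0, 2, 1, by decide, by decide, h'', h'⟩
  · exact ⟨2, 0, 1, by decide, by decide, h'', h⟩
  · exact ⟨1, 0, 2, by decide, by decide, h, h''⟩
  · exact ⟨1, 2, 0, by decide, by decide, h', h''⟩
  · exact ⟨2, 1, 0, by decide, by decide, h', h⟩
  · exact ⟨2, 1, 0, by decide, by decide, h', h⟩

/-- Every vertex order of a ternary strip has a prefix whose cut has a large cover number. -/
theorem exists_threshold {p : ℕ} (s : ℕ) (f : List (Fin 3) × ℕ → ℕ)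
    (hf : Set.InjOn f (ternaryBox (2 * p + s) p)) :
    ∃ j, p ^ 2 ≤ ((ternaryBox (2 * p + s) p).filter fun x => f x < j).card ∧
      p ^ 2 ≤ ((ternaryBox (2 * p + s) p).filter fun x => ¬ f x < j).card ∧
      ∀ W ⊆ ternaryBox (2 * p + s) p,
        (∀ x ∈ ternaryBox (2 * p + s) p, ∀ y ∈ ternaryBox (2 * p + s) p,
          ternaryStrip.Adj x y → f x < j → ¬ f y < j → x ∈ W ∨ y ∈ W) → p * s ≤ W.card := by
  induction s generalizing f with
  | zero =>
    -- The extra height `2 * p` serves only here: it provides more than `2 * p` words, so both sides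
    -- can have `p ^ 2` vertices. These size bounds are what the induction step takes from the two
    -- outer branches.
    have hcard : 2 * p ^ 2 ≤ (ternaryBox (2 * p + 0) p).card := by
      rw [ternaryBox, Finset.card_product, Finset.card_range]
      nlinarith [lt_card_ternaryWords (2 * p + 0)]
    obtain ⟨j, hj⟩ := exists_card_filter_lt_eq hf (p ^ 2) (by omega)
    refine ⟨j, hj.ge, ?_, by simp⟩
    have := Finset.card_filter_add_card_filter_not (s := ternaryBox (2 * p + 0) p)
      (fun x => f x < j)
    omega
  | succ s ih =>
    set B := ternaryBox (2 * p + s) p with hB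
    have hcons : ∀ (i : Fin 3) (x : List (Fin 3) × ℕ),
        (i :: x.1, x.2) ∈ ternaryBox (2 * p + (s + 1)) p ↔ x ∈ B := by
      intro i x
      rw [hB, mem_ternaryBox, mem_ternaryBox, List.length_cons]
      constructor <;> rintro ⟨h, h'⟩ <;> exact ⟨by omega, h'⟩
    have hinj : ∀ i : Fin 3, Function.Injective
        fun x : List (Fin 3) × ℕ => (i :: x.1, x.2) := by
      rintro i ⟨l, h⟩ ⟨l', h'⟩ he
      simpa using he
    choose j hj1 hj2 hj3 using fun i : Fin 3 => ih (fun x => f (i :: x.1, x.2)) (by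
      intro x hx y hy hxy
      exact hinj i (hf ((hcons i x).2 hx) ((hcons i y).2 hy) hxy))
    -- At the median threshold `j b`, branch `b` needs `p * s` covering vertices by induction.
    -- Outside `b`, branch `a` has `p ^ 2` vertices below the threshold and branch `c` has `p ^ 2`
    -- not below it, so the connected rest needs `p` more, disjoint from the former.
    obtain ⟨a, b, c, hab, hcb, hle, hle'⟩ := exists_median j
    set L := (ternaryWords (2 * p + (s + 1))).filter fun l => l.head? ≠ some b with hL
    have hLsub : L ×ˢ Finset.range p ⊆ ternaryBox (2 * p + (s + 1)) p :=
      Finset.product_subset_product_left (Finset.filter_subset _ _)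
    have hmemL : ∀ i : Fin 3, i ≠ b → ∀ x ∈ B, (i :: x.1, x.2) ∈ L ×ˢ Finset.range p := by
      intro i hi x hx
      have := (hcons i x).2 hx
      rw [ternaryBox, Finset.mem_product] at this
      rw [Finset.mem_product, hL, Finset.mem_filter]
      exact ⟨⟨this.1, by simpa using hi⟩, this.2⟩
    have h1 : p ^ 2 ≤ ((L ×ˢ Finset.range p).filter fun x => f x < j b).card := by
      refine (hj1 a).trans (Finset.card_le_card_of_injOn (fun x => (a :: x.1, x.2)) ?_
        (hinj a).injOn)
      intro x hx
      rw [Finset.mem_coe, Finset.mem_filter] at hx ⊢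
      exact ⟨hmemL a hab x hx.1, hx.2.trans_le hle⟩
    have h2 : p ^ 2 ≤ ((L ×ˢ Finset.range p).filter fun x => ¬ f x < j b).card := by
      refine (hj2 c).trans (Finset.card_le_card_of_injOn (fun x => (c :: x.1, x.2)) ?_
        (hinj c).injOn)
      intro x hx
      rw [Finset.mem_coe, Finset.mem_filter] at hx ⊢
      exact ⟨hmemL c hcb x hx.1, fun h => hx.2 (h.trans_le hle')⟩
    refine ⟨j b, h1.trans (Finset.card_le_card (Finset.filter_subset_filter _ hLsub)),
      h2.trans (Finset.card_le_card (Finset.filter_subset_filter _ hLsub)), ?_⟩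
    intro W hWB hW
    set W₁ := B.filter fun x => (b :: x.1, x.2) ∈ W with hW₁
    have hc1 : p * s ≤ W₁.card := by
      refine hj3 b W₁ (Finset.filter_subset _ _) ?_
      rintro ⟨l, h⟩ hx ⟨l', h'⟩ hy hxy hfx hfy
      rcases hW _ ((hcons b _).2 hx) _ ((hcons b _).2 hy) (ternaryStrip_adj_cons_iff.2 hxy)
        hfx hfy with h | h
      · exact Or.inl (Finset.mem_filter.2 ⟨hx, h⟩)
      · exact Or.inr (Finset.mem_filter.2 ⟨hy, h⟩)
    have hc2 : p ≤ (W ∩ L ×ˢ Finset.range p).card := by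
      refine le_card_cover_of_sq_le ?_ h1 h2 ?_
      · intro l i hl
        rw [hL, Finset.mem_filter, mem_ternaryWords, List.length_append] at hl
        rw [hL, Finset.mem_filter, mem_ternaryWords]
        refine ⟨(Nat.le_add_right _ _).trans hl.1, fun h => hl.2 ?_⟩
        cases l with
        | nil => simp at h
        | cons => exact h
      · intro x hx y hy hxy hfx hfy
        rw [Finset.mem_inter, Finset.mem_inter]
        rcases hW x (hLsub hx) y (hLsub hy) hxy hfx hfy with h | h
        · exact Or.inl ⟨h, hx⟩
        · exact Or.inr ⟨h, hy⟩
    have hdisj : Disjoint (W₁.image fun x => (b :: x.1, x.2)) (W ∩ L ×ˢ Finset.range p) := by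
      rw [Finset.disjoint_left]
      intro x hx hx'
      obtain ⟨y, -, rfl⟩ := Finset.mem_image.1 hx
      simp [hL] at hx'
    calc p * (s + 1) = p * s + p := by ring
      _ ≤ (W₁.image fun x => (b :: x.1, x.2)).card + (W ∩ L ×ˢ Finset.range p).card := by
        rw [Finset.card_image_of_injective _ (hinj b)]
        exact add_le_add hc1 hc2
      _ = _ := (Finset.card_union_of_disjoint hdisj).symm
      _ ≤ W.card := by
        apply Finset.card_le_card
        apply Finset.union_subset _ Finset.inter_subset_left
        intro x hx
        obtain ⟨y, hy, rfl⟩ := Finset.mem_image.1 hx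
        exact (Finset.mem_filter.1 hy).2

/-- A chain of sets is refined by an injective ranking of the vertices. -/
theorem IsChain.exists_ranking {V : Type*} [Fintype V] {𝒞 : Set (Set V)}
    (h𝒞 : IsChain (· ⊆ ·) 𝒞) :
    ∃ f : V → ℕ, Function.Injective f ∧ ∀ C ∈ 𝒞, ∀ v ∈ C, ∀ w ∉ C, f v < f w := by
  classical
  have e := Fintype.equivFin V
  -- Rank by the number of chain members missing the vertex; the enumeration `e` breaks ties.
  set g : V → ℕ := fun v => (Finset.univ.filter fun C : Set V => C ∈ 𝒞 ∧ v ∉ C).card with hg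
  have hlt : ∀ v, (e v : ℕ) < Fintype.card V := fun v => (e v).2
  refine ⟨fun v => g v * Fintype.card V + e v, fun v w h => ?_, fun C hC v hv w hw => ?_⟩
  · have h' := congrArg (· % Fintype.card V) h
    simp only [Nat.mul_add_mod_self_right, Nat.mod_eq_of_lt (hlt _)] at h'
    exact e.injective (Fin.ext h')
  · have hgvw : g v < g w := by
      apply Finset.card_lt_card
      rw [Finset.ssubset_iff_of_subset]
      · exact ⟨C, by simp [hC, hw], by simp [hv]⟩
      · intro D hD
        simp only [Finset.mem_filter, Finset.mem_univ, true_and] at hD ⊢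
        refine ⟨hD.1, fun hwD => ?_⟩
        rcases h𝒞.total hC hD.1 with h | h
        · exact hD.2 (h hv)
        · exact hw (h hwD)
    have := Nat.mul_le_mul_right (Fintype.card V) (Nat.succ_le_of_lt hgvw)
    have := hlt v
    rw [Nat.succ_mul] at *
    show g v * _ + _ < g w * _ + _
    omega

/-- The graph on `Fin m` given by an enumeration of vertices of the strip. -/
abbrev stripGraph {m : ℕ} (φ : Fin m → List (Fin 3) × ℕ) : SimpleGraph (Fin m) :=
  ternaryStrip.comap φ

/-- A prefix of an order refining the chain is comparable with every member of the chain, so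
`exists_threshold` applies to the ranking. -/
theorem stripGraph_exists_cut {p s m : ℕ} (hp : 0 < p) {φ : Fin m → List (Fin 3) × ℕ}
    (hφ : Function.Injective φ) (hrange : ∀ x, x ∈ ternaryBox (2 * p + s) p ↔ ∃ a, φ a = x)
    {𝒞 : Set (Set (Fin m))} (h𝒞 : IsChain (· ⊆ ·) 𝒞) :
    ∃ Z, (∀ C ∈ 𝒞, Z ⊆ C ∨ C ⊆ Z) ∧ (stripGraph φ).CutCover Z (p * s) := by
  obtain ⟨f, hf, hfC⟩ := h𝒞.exists_ranking
  have : Nonempty (Fin m) :=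
    ⟨((hrange ([], 0)).1 (mem_ternaryBox.2 ⟨Nat.zero_le _, hp⟩)).choose⟩
  set ψ := Function.invFun φ with hψ
  have hl : ∀ a, ψ (φ a) = a := Function.leftInverse_invFun hφ
  obtain ⟨j, -, -, hj⟩ := exists_threshold (p := p) s (f ∘ ψ) (by
    intro x hx y hy hxy
    obtain ⟨a, rfl⟩ := (hrange x).1 hx
    obtain ⟨b, rfl⟩ := (hrange y).1 hy
    simp only [Function.comp, hl] at hxy
    rw [hf hxy])
  refine ⟨{a | f a < j}, fun C hC => ?_, fun W hW => ?_⟩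
  · by_contra! h
    obtain ⟨h1, h2⟩ := h
    rw [Set.not_subset] at h1 h2
    obtain ⟨w, hw, hwC⟩ := h1
    obtain ⟨v, hv, hvj⟩ := h2
    exact hvj ((hfC C hC v hv w hwC).trans hw)
  · classical
    have := hj (W.image φ) (fun x hx => by
        obtain ⟨a, -, rfl⟩ := Finset.mem_image.1 hx
        exact (hrange _).2 ⟨a, rfl⟩) (by
      intro x hx y hy hxy hfx hfy
      obtain ⟨a, rfl⟩ := (hrange x).1 hx
      obtain ⟨b, rfl⟩ := (hrange y).1 hy
      simp only [Function.comp, hl] at hfx hfy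
      rcases hW a b hxy hfx hfy with h | h
      · exact Or.inl (Finset.mem_image_of_mem _ h)
      · exact Or.inr (Finset.mem_image_of_mem _ h))
    rwa [Finset.card_image_of_injective _ hφ] at this

/-! ### Treewidth of the strips -/

/-- Descending depth connects everything to the root, and every edge is `s(a, par a)` for some `a ≠
root`, so there are too few edges for a cycle. -/
theorem SimpleGraph.isTree_of_parent {T : Type*} [Finite T] (tree : SimpleGraph T) (root : T)
    (par : T → T) (depth : T → ℕ) (hd : ∀ a, a ≠ root → depth (par a) < depth a)
    (hadj : ∀ a, a ≠ root → tree.Adj a (par a))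
    (hpar : ∀ a b, tree.Adj a b → (a ≠ root ∧ b = par a) ∨ (b ≠ root ∧ a = par b)) :
    tree.IsTree := by
  have hconn : tree.Connected := by
    rw [connected_iff_exists_forall_reachable]
    refine ⟨root, fun a => ?_⟩
    induction hn : depth a using Nat.strong_induction_on generalizing a with
    | _ n ih =>
      by_cases ha : a = root
      · rw [ha]
      · exact (ih _ (hn ▸ hd a ha) (par a) rfl).trans (hadj a ha).reachable.symm
  rw [isTree_iff_connected_and_card]
  refine ⟨hconn, le_antisymm ?_ hconn.card_vert_le_card_edgeSet_add_one⟩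
  have hsub : tree.edgeSet ⊆ (fun a => s(a, par a)) '' {root}ᶜ := by
    intro e
    induction e using Sym2.ind with
    | _ a b =>
      intro h
      rcases hpar a b h with ⟨ha, rfl⟩ | ⟨hb, rfl⟩
      · exact ⟨a, ha, rfl⟩
      · exact ⟨b, hb, Sym2.eq_swap⟩
  have h1 := (Set.ncard_le_ncard hsub (Set.toFinite _)).trans (Set.ncard_image_le (Set.toFinite _))
  have h2 := Set.ncard_add_ncard_compl {root}
  rw [Set.ncard_singleton] at h2
  rw [Nat.card_coe_set_eq]
  omega

/-- The ternary tree of height `r`. -/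
def ternaryTree (r : ℕ) : SimpleGraph {l // l ∈ ternaryWords r} :=
  SimpleGraph.fromRel fun a b => a.1 ≠ [] ∧ b.1 = a.1.dropLast

theorem dropLast_mem_ternaryWords {r : ℕ} {l : List (Fin 3)} (hl : l ∈ ternaryWords r) :
    l.dropLast ∈ ternaryWords r := by
  rw [mem_ternaryWords] at *
  rw [List.length_dropLast]
  omega

theorem dropLast_length_lt {α : Type*} {l : List α} (hl : l ≠ []) : l.dropLast.length < l.length := by
  have := List.length_pos_iff.2 hl
  rw [List.length_dropLast]
  omega

theorem ternaryTree_adj {r : ℕ} {a b : {l // l ∈ ternaryWords r}} (ha : a.1 ≠ [])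
    (hb : b.1 = a.1.dropLast) : (ternaryTree r).Adj a b := by
  rw [ternaryTree, SimpleGraph.fromRel_adj]
  refine ⟨fun h => ?_, Or.inl ⟨ha, hb⟩⟩
  have := dropLast_length_lt ha
  rw [← hb, h] at this
  exact this.false

theorem ternaryTree_isTree (r : ℕ) : (ternaryTree r).IsTree := by
  refine SimpleGraph.isTree_of_parent _ ⟨[], mem_ternaryWords.2 (Nat.zero_le _)⟩
    (fun a => ⟨a.1.dropLast, dropLast_mem_ternaryWords a.2⟩) (fun a => a.1.length) ?_ ?_ ?_
  · intro a ha
    exact dropLast_length_lt fun h => ha (Subtype.ext h)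
  · intro a ha
    exact ternaryTree_adj (fun h => ha (Subtype.ext h)) rfl
  · intro a b h
    rw [ternaryTree, SimpleGraph.fromRel_adj] at h
    rcases h.2 with ⟨h, h'⟩ | ⟨h, h'⟩
    · exact Or.inl ⟨fun h0 => h (congrArg Subtype.val h0), Subtype.ext h'⟩
    · exact Or.inr ⟨fun h0 => h (congrArg Subtype.val h0), Subtype.ext h'⟩

open Classical in
/-- The tree decomposition of a strip whose bags are the unions of adjacent copies of the path. -/
noncomputable def stripDecomposition {r p m : ℕ} {φ : Fin m → List (Fin 3) × ℕ}
    (hmem : ∀ a, φ a ∈ ternaryBox r p) : (stripGraph φ).TreeDecomposition where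
  T := {l // l ∈ ternaryWords r}
  tree := ternaryTree r
  isTree := ternaryTree_isTree r
  bag t := Finset.univ.filter fun a => (φ a).1 = t.1 ∨ (φ a).1 = t.1.dropLast
  union a := ⟨⟨(φ a).1, (Finset.mem_product.1 (hmem a)).1⟩, by simp⟩
  containment a b hab := by
    have ha := (Finset.mem_product.1 (hmem a)).1
    have hb := (Finset.mem_product.1 (hmem b)).1
    rcases hab with ⟨h, -⟩ | ⟨-, ⟨i, h⟩ | ⟨i, h⟩⟩
    · exact ⟨⟨_, ha⟩, by simp [h]⟩
    · exact ⟨⟨_, hb⟩, by simp [h]⟩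
    · exact ⟨⟨_, ha⟩, by simp [h]⟩
  connectedness a := by
    rw [SimpleGraph.connected_iff_exists_forall_reachable]
    refine ⟨⟨⟨(φ a).1, (Finset.mem_product.1 (hmem a)).1⟩, by simp⟩, ?_⟩
    rintro ⟨t, ht⟩
    have ht' : (φ a).1 = t.1 ∨ (φ a).1 = t.1.dropLast := by simpa using ht
    -- The nodes whose bags contain `a` are the word of `a` and its children: a star.
    by_cases h : (φ a).1 = t.1
    · have : t = ⟨(φ a).1, (Finset.mem_product.1 (hmem a)).1⟩ := Subtype.ext h.symm
      subst this
      rfl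
    · have h' := ht'.resolve_left h
      refine (SimpleGraph.Adj.reachable ?_).symm
      refine ternaryTree_adj (fun h0 => h ?_) h'
      change t.1 = [] at h0
      rw [h', h0, List.dropLast_nil]

theorem stripGraph_treewidth_le {r p m : ℕ} {φ : Fin m → List (Fin 3) × ℕ}
    (hφ : Function.Injective φ) (hmem : ∀ a, φ a ∈ ternaryBox r p) :
    (stripGraph φ).treewidth ≤ 2 * p - 1 := by
  classical
  have hle : (stripGraph φ).treewidth ≤ (stripDecomposition hmem).width :=
    Nat.sInf_le (Set.mem_range_self _)
  refine hle.trans (Nat.sub_le_sub_right ?_ 1)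
  refine Finset.sup_le fun t _ => ?_
  calc _ ≤ (({t.1, t.1.dropLast} : Finset (List (Fin 3))) ×ˢ Finset.range p).card := by
        refine Finset.card_le_card_of_injOn φ (fun a ha => ?_) hφ.injOn
        have ha : (φ a).1 = t.1 ∨ (φ a).1 = t.1.dropLast := by
          simpa [stripDecomposition] using ha
        rw [Finset.mem_coe, Finset.mem_product]
        exact ⟨by simpa using ha, (Finset.mem_product.1 (hmem a)).2⟩
    _ ≤ 2 * p := by
        rw [Finset.card_product, Finset.card_range]
        exact Nat.mul_le_mul_right _ Finset.card_le_two

theorem stripGraph_degree_le {m : ℕ} {φ : Fin m → List (Fin 3) × ℕ}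
    (hφ : Function.Injective φ) (v : Fin m) :
    ∃ A : Finset (Fin m), A.card ≤ 6 ∧ ∀ w, (stripGraph φ).Adj v w → w ∈ A := by
  classical
  -- Two path neighbours, three children and the parent. At coordinate `0` or the empty word,
  -- truncation merely adds the vertex itself.
  set A : Finset (List (Fin 3) × ℕ) := {((φ v).1, (φ v).2 + 1), ((φ v).1, (φ v).2 - 1),
    ((φ v).1 ++ [0], (φ v).2), ((φ v).1 ++ [1], (φ v).2), ((φ v).1 ++ [2], (φ v).2),
    ((φ v).1.dropLast, (φ v).2)} with hA
  refine ⟨Finset.univ.filter fun w => φ w ∈ A, ?_, fun w hw => ?_⟩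
  · exact (Finset.card_le_card_of_injOn φ (t := A) (fun w hw => (Finset.mem_filter.1 hw).2)
      hφ.injOn).trans Finset.card_le_six
  · rw [Finset.mem_filter]
    refine ⟨Finset.mem_univ _, ?_⟩
    rw [SimpleGraph.comap_adj] at hw
    generalize φ v = x at *
    generalize φ w = y at *
    obtain ⟨l, h⟩ := x
    obtain ⟨l', h'⟩ := y
    simp only [hA, Finset.mem_insert, Finset.mem_singleton, Prod.mk.injEq]
    rcases hw with ⟨h1, h2 | h2⟩ | ⟨h1, ⟨i, h2⟩ | ⟨i, h2⟩⟩ <;> dsimp only at h1 h2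
    · exact Or.inl ⟨h1.symm, h2⟩
    · exact Or.inr (Or.inl ⟨h1.symm, by omega⟩)
    · subst h1 h2
      fin_cases i <;> simp
    · subst h1 h2
      simp

theorem stripGraph_exists_adj {r p m : ℕ} (hp : 2 ≤ p) {φ : Fin m → List (Fin 3) × ℕ}
    (hrange : ∀ x, x ∈ ternaryBox r p ↔ ∃ a, φ a = x) (v : Fin m) :
    ∃ w, (stripGraph φ).Adj v w := by
  have hv := mem_ternaryBox.1 ((hrange _).2 ⟨v, rfl⟩)
  by_cases h : (φ v).2 + 1 < p
  · obtain ⟨w, hw⟩ := (hrange ((φ v).1, (φ v).2 + 1)).1 (mem_ternaryBox.2 ⟨hv.1, h⟩)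
    exact ⟨w, Or.inl (by simp [hw])⟩
  · obtain ⟨w, hw⟩ := (hrange ((φ v).1, (φ v).2 - 1)).1
      (mem_ternaryBox.2 ⟨hv.1, (Nat.sub_le _ _).trans_lt hv.2⟩)
    refine ⟨w, Or.inl ⟨by simp [hw], Or.inr ?_⟩⟩
    rw [hw]
    dsimp only
    omega

/-! ### The formulas -/

theorem SimpleGraph.monotoneCNF_numVars {m : ℕ} {G : SimpleGraph (Fin m)}
    (hG : ∀ v, ∃ w, G.Adj v w) : G.monotoneCNF.numVars = m := by
  have : G.monotoneCNF.vars = Set.univ := by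
    ext v
    obtain ⟨w, hw⟩ := hG v
    exact iff_of_true ⟨_, ⟨v, w, hw, rfl⟩, ⟨v, true⟩, Or.inl rfl, rfl⟩ trivial
  rw [CNFFormula.numVars, this, Set.ncard_univ, Nat.card_fin]

theorem SimpleGraph.monotoneCNF_primalGraph {V : Type*} (G : SimpleGraph V) :
    G.monotoneCNF.primalGraph = G := by
  ext a b
  rw [CNFFormula.primalGraph, SimpleGraph.fromRel_adj]
  constructor
  · rintro ⟨hne, h | h⟩ <;>
    · obtain ⟨_, ⟨u, v, huv, rfl⟩, ⟨l, hl, rfl⟩, l', hl', rfl⟩ := h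
      rcases hl with rfl | rfl <;> rcases hl' with rfl | rfl
      · exact absurd rfl hne
      · first | exact huv | exact huv.symm
      · first | exact huv | exact huv.symm
      · exact absurd rfl hne
  · intro h
    exact ⟨h.ne, Or.inl ⟨_, ⟨a, b, h, rfl⟩, ⟨⟨a, true⟩, Or.inl rfl, rfl⟩,
      ⟨⟨b, true⟩, Or.inr rfl, rfl⟩⟩⟩

/-! ### The lower bound -/

/-- Since `(65 / 64) ^ 64 ≥ 2`, the hypothesis gives `2 ^ t ≤ (2 * Q) ^ 64`. Squaring produces a
spare `2 ^ t`, which absorbs the constant `2 ^ 128`. -/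
theorem two_pow_le_of_pow_le {t Q : ℕ} (ht : 128 ≤ t)
    (h : (2 ^ 6 + 1) ^ t ≤ 2 * Q * (2 ^ 6) ^ t) : 2 ^ t ≤ Q ^ 128 := by
  have h1 : 2 ^ t ≤ (2 * Q) ^ 64 := by
    have hpos : 0 < ((2 ^ 6) ^ 64) ^ t := by positivity
    refine Nat.le_of_mul_le_mul_right ?_ hpos
    calc 2 ^ t * ((2 ^ 6) ^ 64) ^ t = (2 * (2 ^ 6) ^ 64) ^ t := (mul_pow _ _ _).symm
      _ ≤ ((2 ^ 6 + 1) ^ 64) ^ t := Nat.pow_le_pow_left (by norm_num) _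
      _ = ((2 ^ 6 + 1) ^ t) ^ 64 := by rw [← pow_mul, ← pow_mul, mul_comm]
      _ ≤ (2 * Q * (2 ^ 6) ^ t) ^ 64 := Nat.pow_le_pow_left h _
      _ = (2 * Q) ^ 64 * ((2 ^ 6) ^ 64) ^ t := by
        rw [mul_pow, ← pow_mul (2 ^ 6) t 64, ← pow_mul (2 ^ 6) 64 t, mul_comm t]
  have hpos : 0 < 2 ^ t := by positivity
  refine Nat.le_of_mul_le_mul_left ?_ hpos
  calc 2 ^ t * 2 ^ t ≤ (2 * Q) ^ 64 * (2 * Q) ^ 64 := Nat.mul_le_mul h1 h1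
    _ = 2 ^ 128 * Q ^ 128 := by rw [← pow_add, mul_pow]
    _ ≤ 2 ^ t * Q ^ 128 := Nat.mul_le_mul_right _ (Nat.pow_le_pow_right (by norm_num) ht)

theorem card_ternaryBox_pow_le {k p s : ℕ} (hkp : k ≤ 2 * p) (hs : 2 * p ≤ s) :
    (ternaryBox (2 * p + s) p).card ^ k ≤ (2 ^ (p * s)) ^ 12 := by
  have hp : p ≤ 2 ^ (2 * p + s) := by
    have := Nat.lt_two_pow_self (n := 2 * p + s)
    omega
  have h : (ternaryBox (2 * p + s) p).card ≤ 2 ^ (6 * s) := by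
    rw [ternaryBox, Finset.card_product, Finset.card_range]
    calc _ ≤ 4 ^ (2 * p + s) * 2 ^ (2 * p + s) := Nat.mul_le_mul (card_ternaryWords_le _) hp
      _ = 2 ^ (3 * (2 * p + s)) := by
        rw [← mul_pow, pow_mul]
        norm_num
      _ ≤ _ := Nat.pow_le_pow_right (by norm_num) (by omega)
  calc _ ≤ (2 ^ (6 * s)) ^ k := Nat.pow_le_pow_left h _
    _ ≤ (2 ^ (6 * s)) ^ (2 * p) := Nat.pow_le_pow_right (by positivity) hkp
    _ = _ := by
      rw [← pow_mul, ← pow_mul]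
      congr 1
      ring

theorem stripGraph_pow_le {k p s m : ℕ} (hp : 2 ≤ p) (hkp : k ≤ 2 * p) (hs : 2 * p + 128 ≤ s)
    {φ : Fin m → List (Fin 3) × ℕ} (hφ : Function.Injective φ)
    (hrange : ∀ x, x ∈ ternaryBox (2 * p + s) p ↔ ∃ a, φ a = x)
    {N E : Type*} [Fintype N] [Fintype E] (Y : NROBP (Fin m) N E)
    (hY : Y.Computes (stripGraph φ).monotoneCNF.Sat) :
    m ^ k ≤ Fintype.card N ^ 3072 ∧ m ^ k ≤ Fintype.card E ^ 3072 := by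
  classical
  have hm : m = (ternaryBox (2 * p + s) p).card := by
    rw [← Fintype.card_fin m, ← Finset.card_univ, ← Finset.card_image_of_injective _ hφ]
    congr 1
    ext x
    simp [hrange]
  obtain ⟨v, -⟩ := (hrange ([], 0)).1 (mem_ternaryBox.2 ⟨Nat.zero_le _, by omega⟩)
  have hQ := Y.pow_le_card_pairs hY ⟨v, stripGraph_exists_adj hp hrange v⟩
    (stripGraph_degree_le hφ) fun _ h => stripGraph_exists_cut (by omega) hφ hrange h
  set Q := (Finset.univ.image fun e : E => (Y.tail e, Y.head e)).card
  have hQm : m ^ k ≤ Q ^ 1536 := by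
    rw [hm]
    refine (card_ternaryBox_pow_le hkp (by omega)).trans ?_
    calc _ ≤ (Q ^ 128) ^ 12 :=
          Nat.pow_le_pow_left (two_pow_le_of_pow_le (by nlinarith) hQ) _
      _ = Q ^ (128 * 12) := (pow_mul _ _ _).symm
  have hQE : Q ≤ Fintype.card E := Finset.card_image_le
  -- Counting pairs of nodes instead of edges makes parallel edges harmless; the square doubles
  -- `1536 = 128 * 12` to `3072`.
  have hQN : Q ≤ Fintype.card N ^ 2 := by
    refine (Finset.card_le_univ _).trans ?_
    rw [Fintype.card_prod, sq]
  constructor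
  · calc _ ≤ (Fintype.card N ^ 2) ^ 1536 := hQm.trans (Nat.pow_le_pow_left hQN _)
      _ = Fintype.card N ^ (2 * 1536) := (pow_mul _ _ _).symm
  · have hQpos : 0 < Q := by
      rcases Nat.eq_zero_or_pos Q with h | h
      · rw [h] at hQ
        simp at hQ
      · exact h
    calc _ ≤ Fintype.card E ^ 1536 := hQm.trans (Nat.pow_le_pow_left hQE _)
      _ ≤ _ := Nat.pow_le_pow_right (hQpos.trans_le hQE) (by norm_num)

theorem rpow_div_le_of_pow_le {m k a : ℕ} (h : m ^ k ≤ a ^ 3072) :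
    (m : ℝ) ^ ((k : ℝ) / 3072) ≤ a := by
  have hm : (0 : ℝ) ≤ m := Nat.cast_nonneg m
  refine (pow_le_pow_iff_left₀ (Real.rpow_nonneg hm _) (Nat.cast_nonneg a)
    (by norm_num : 3072 ≠ 0)).1 ?_
  rw [← Real.rpow_natCast, ← Real.rpow_mul hm]
  have : (k : ℝ) / 3072 * ((3072 : ℕ) : ℝ) = k := by
    push_cast
    field_simp
  rw [this, Real.rpow_natCast]
  exact_mod_cast h

theorem exists_infinite_class (k : ℕ) (hk : 3 ≤ k) :
    ∃ 𝒢 : Set (Σ m : ℕ, SimpleGraph (Fin m)), 𝒢.Infinite ∧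
      ∀ G ∈ 𝒢, (∀ v, ∃ w, G.2.Adj v w) ∧ G.2.treewidth ≤ k ∧
        ∀ (N E : Type) [Fintype N] [Fintype E] (Y : NROBP (Fin G.1) N E),
          Y.Computes G.2.monotoneCNF.Sat →
            (G.2.monotoneCNF.numVars : ℝ) ^ ((k : ℝ) / 3072) ≤ (Fintype.card N : ℝ) ∧
            (G.2.monotoneCNF.numVars : ℝ) ^ ((k : ℝ) / 3072) ≤ (Fintype.card E : ℝ) := by
  obtain ⟨p, hp, hpk, hkp⟩ : ∃ p, 2 ≤ p ∧ 2 * p - 1 ≤ k ∧ k ≤ 2 * p :=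
    ⟨(k + 1) / 2, by omega, by omega, by omega⟩
  refine ⟨{G | ∃ s, 2 * p + 128 ≤ s ∧ G.1 = (ternaryBox (2 * p + s) p).card ∧
    ∃ φ : Fin G.1 → List (Fin 3) × ℕ, Function.Injective φ ∧
      (∀ x, x ∈ ternaryBox (2 * p + s) p ↔ ∃ a, φ a = x) ∧ G.2 = stripGraph φ}, ?_, ?_⟩
  -- The vertex counts are unbounded, so the class is infinite even up to isomorphism.
  · refine Set.Infinite.of_image Sigma.fst (Set.infinite_of_forall_exists_gt fun n => ?_)
    set B := ternaryBox (2 * p + (2 * p + 128 + n)) p with hB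
    refine ⟨B.card, ⟨⟨B.card, stripGraph fun a => (B.equivFin.symm a : List (Fin 3) × ℕ)⟩,
      ⟨2 * p + 128 + n, by omega, rfl, _, ?_, fun x => ⟨fun hx => ?_, ?_⟩, rfl⟩, rfl⟩, ?_⟩
    · exact Subtype.val_injective.comp B.equivFin.symm.injective
    · exact ⟨B.equivFin ⟨x, hx⟩, by simp⟩
    · rintro ⟨a, rfl⟩
      exact (B.equivFin.symm a).2
    · rw [hB, ternaryBox, Finset.card_product, Finset.card_range]
      have := lt_card_ternaryWords (2 * p + (2 * p + 128 + n))
      nlinarith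
  · rintro ⟨m, G⟩ ⟨s, hs, -, φ, hφ, hrange, hG⟩
    dsimp only at φ hφ hrange hG
    subst hG
    have hadj := stripGraph_exists_adj hp hrange
    refine ⟨hadj, (stripGraph_treewidth_le hφ fun a => (hrange _).2 ⟨a, rfl⟩).trans hpk, ?_⟩
    intro N E _ _ Y hY
    have := stripGraph_pow_le hp hkp hs hφ hrange Y hY
    rw [SimpleGraph.monotoneCNF_numVars hadj]
    exact ⟨rpow_div_le_of_pow_le this.1, rpow_div_le_of_pow_le this.2⟩

theorem exists_mem_lt_of_infinite {𝒢 : Set (Σ m : ℕ, SimpleGraph (Fin m))} (h : 𝒢.Infinite)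
    (M : ℕ) : ∃ G ∈ 𝒢, M < G.1 := by
  by_contra! hle
  refine h (Set.Finite.subset (Set.finite_range fun q : Σ m : Fin (M + 1), SimpleGraph (Fin m) =>
    (⟨q.1, q.2⟩ : Σ m : ℕ, SimpleGraph (Fin m))) fun G hG => ?_)
  exact ⟨⟨⟨G.1, Nat.lt_succ_of_le (hle G hG)⟩, G.2⟩, rfl⟩

theorem theorem1 :
    (∃ c : ℝ, 0 < c ∧ ∀ k : ℕ, 3 ≤ k →
      ∃ 𝒢 : Set (Σ m : ℕ, SimpleGraph (Fin m)), 𝒢.Infinite ∧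
        ∀ G ∈ 𝒢, (∀ v, ∃ w, G.2.Adj v w) ∧ G.2.treewidth ≤ k ∧
          ∀ (N E : Type) [Fintype N] [Fintype E] (Y : NROBP (Fin G.1) N E),
            Y.Computes G.2.monotoneCNF.Sat →
              (G.2.monotoneCNF.numVars : ℝ) ^ ((k : ℝ) / c) ≤ (Fintype.card N : ℝ) ∧
              (G.2.monotoneCNF.numVars : ℝ) ^ ((k : ℝ) / c) ≤ (Fintype.card E : ℝ)) ∧
    ¬ ∃ (f : ℕ → ℝ) (d : ℝ), ∀ (k m : ℕ) (G : SimpleGraph (Fin m)),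
        (∀ v, ∃ w, G.Adj v w) → G.monotoneCNF.primalGraph.treewidth ≤ k →
          ∃ (N E : Type) (_ : Fintype N) (_ : Fintype E) (Y : NROBP (Fin m) N E),
            Y.Computes G.monotoneCNF.Sat ∧
              ((Fintype.card N : ℝ) ≤ f k * (G.monotoneCNF.numVars : ℝ) ^ d ∨
               (Fintype.card E : ℝ) ≤ f k * (G.monotoneCNF.numVars : ℝ) ^ d) := by
  refine ⟨⟨3072, by norm_num, exists_infinite_class⟩, ?_⟩
  rintro ⟨f, d, h⟩
  -- With exponent `k / 3072 ≥ d + 1`, the two bounds force `m ≤ f k`, which fails for a large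
  -- member of the class.
  obtain ⟨k₀, hk₀⟩ := exists_nat_ge ((d + 1) * 3072)
  set k := max 3 k₀ with hk
  have hkd : d + 1 ≤ (k : ℝ) / 3072 := by
    rw [le_div_iff₀ (by norm_num)]
    exact hk₀.trans (by exact_mod_cast le_max_right 3 k₀)
  obtain ⟨𝒢, hinf, h𝒢⟩ := exists_infinite_class k (le_max_left _ _)
  obtain ⟨M, hM⟩ := exists_nat_ge (f k)
  obtain ⟨⟨m, G⟩, hG, hm⟩ := exists_mem_lt_of_infinite hinf M
  obtain ⟨hadj, htw, hsize⟩ := h𝒢 _ hG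
  obtain ⟨N, E, _, _, Y, hY, hle⟩ := h k m G hadj (by rwa [SimpleGraph.monotoneCNF_primalGraph])
  have hlow := hsize N E Y hY
  dsimp only at hm hadj hlow
  rw [SimpleGraph.monotoneCNF_numVars hadj] at hlow hle
  have hm1 : (1 : ℝ) ≤ m := by exact_mod_cast (Nat.zero_le M).trans_lt hm
  have hup : (m : ℝ) ^ ((k : ℝ) / 3072) ≤ f k * (m : ℝ) ^ d :=
    hle.elim hlow.1.trans hlow.2.trans
  have hpos : (0 : ℝ) < (m : ℝ) ^ d := Real.rpow_pos_of_pos (by linarith) d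
  have hd1 : (m : ℝ) ^ (d + 1) = m * (m : ℝ) ^ d := by
    rw [Real.rpow_add_one (by linarith), mul_comm]
  have := (Real.rpow_le_rpow_of_exponent_le hm1 hkd).trans hup
  rw [hd1] at this
  have hmf := le_of_mul_le_mul_right this hpos
  have : (M : ℝ) < m := by exact_mod_cast hm
  linarith
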